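/- We work over $\mathbb{C}$. Let $R$ be an integral domain that is a finitely generated $\mathbb{C}$-algebra, and let $Z=\operatorname{Spec} R$ be the corresponding affine variety. Let $X$ and $Y$ be normal varieties equipped with projective morphisms $X\to Z$ and $Y\to Z$, and let $f\colon X\to Y$ be a surjective morphism over $Z$. Let $L$ be a Cartier divisor on $Y$, and let $f^*L$ be its pullback, the Cartier divisor on $X$ obtained by pulling back local equations of $L$. For a Cartier divisor $D$ on a normal variety $W$ projective over $Z$, let $$R(W/Z,D)=\bigoplus_{m\ge 0}H^0(W,\mathcal{O}_W(mD)),$$ where $H^0(W,\mathcal{O}_W(mD))$ is the set of rational functions $s$ on $W$ such that $s\,g^m$ is regular at $x$ for every point $x\in W$ and every local equation $g$ of $D$ at $x$; multiplication is induced by that of the function field, and the $R$-algebra structure comes from $W\to Z$. If $R(X/Z,f^*L)$ is a finitely generated $R$-algebra, then $R(Y/Z,L)$ is also a finitely generated $R$-algebra. -/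

import Mathlib

open AlgebraicGeometry CategoryTheory
open scoped DirectSum

noncomputable section

namespace SectionRings

universe u

section Projective

attribute [local instance] MvPolynomial.gradedAlgebra

/-- A scheme is normal if all its local rings are integrally closed domains. -/
def IsNormalScheme (X : Scheme.{u}) : Prop :=
  ∀ x : X, IsDomain (X.presheaf.stalk x) ∧ IsIntegrallyClosed (X.presheaf.stalk x)

/-- Projective `n`-space over `Spec R`, that is, `Proj R[x₀, …, xₙ]`. -/
def ProjectiveSpace (n : ℕ) (R : Type u) [CommRing R] : Scheme.{u} :=
  Proj (MvPolynomial.homogeneousSubmodule (Fin (n + 1)) R)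

/-- The structure morphism `ℙⁿ_R ⟶ Spec R`. -/
def ProjectiveSpace.toBase (n : ℕ) (R : Type u) [CommRing R] :
    ProjectiveSpace n R ⟶ Spec (.of R) :=
  Proj.toSpecZero (MvPolynomial.homogeneousSubmodule (Fin (n + 1)) R) ≫
    Spec.map (CommRingCat.ofHom
      (algebraMap R (MvPolynomial.homogeneousSubmodule (Fin (n + 1)) R 0)))

/-- A morphism to an affine scheme is projective if it factors as a closed immersion into
some projective space over the base, followed by the structure morphism. -/
def IsProjectiveMorphism {X : Scheme.{u}} {R : Type u} [CommRing R]
    (p : X ⟶ Spec (.of R)) : Prop :=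
  ∃ (n : ℕ) (i : X ⟶ ProjectiveSpace n R),
    IsClosedImmersion i ∧ i ≫ ProjectiveSpace.toBase n R = p

end Projective

section Cartier

variable (X : Scheme.{u}) [IsIntegral X]

/-- The image of `𝒪_{X,x}ˣ` in `K(X)ˣ`. -/
def stalkUnits (x : X) : Subgroup (X.functionField)ˣ :=
  (Units.map (algebraMap (X.presheaf.stalk x) X.functionField).toMonoidHom).range

/-- The group of global sections of the sheaf `K(X)ˣ / 𝒪_Xˣ`, written multiplicatively:
families of germs in `K(X)ˣ / 𝒪_{X,x}ˣ` that are locally induced by one rational function. -/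
def cartierSubgroup : Subgroup (∀ x : X, (X.functionField)ˣ ⧸ stalkUnits X x) where
  carrier := {D | ∀ x : X, ∃ (U : X.Opens) (g : (X.functionField)ˣ), x ∈ U ∧
    ∀ y ∈ U, D y = QuotientGroup.mk g}
  one_mem' x := ⟨⊤, 1, trivial, fun _ _ => rfl⟩
  mul_mem' {D E} hD hE x := by
    obtain ⟨U, g, hxU, hg⟩ := hD x
    obtain ⟨V, h, hxV, hh⟩ := hE x
    refine ⟨U ⊓ V, g * h, ⟨hxU, hxV⟩, fun y hy => ?_⟩
    rw [Pi.mul_apply, hg y hy.1, hh y hy.2, QuotientGroup.mk_mul]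
  inv_mem' {D} hD x := by
    obtain ⟨U, g, hxU, hg⟩ := hD x
    refine ⟨U, g⁻¹, hxU, fun y hy => ?_⟩
    rw [Pi.inv_apply, hg y hy, QuotientGroup.mk_inv]

/-- The additive group of Cartier divisors on an integral scheme. -/
def CartierDivisor : Type u := Additive (cartierSubgroup X)

instance : AddCommGroup (CartierDivisor X) :=
  inferInstanceAs (AddCommGroup (Additive (cartierSubgroup X)))

variable {X}

/-- The germ of a Cartier divisor at a point, a class in `K(X)ˣ / 𝒪_{X,x}ˣ`. -/
def CartierDivisor.germ (D : CartierDivisor X) (x : X) :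
    (X.functionField)ˣ ⧸ stalkUnits X x :=
  (Additive.toMul D : cartierSubgroup X).1 x

lemma CartierDivisor.germ_zero (x : X) :
    (0 : CartierDivisor X).germ x = QuotientGroup.mk 1 := rfl

lemma CartierDivisor.germ_add (D E : CartierDivisor X) (x : X) :
    (D + E).germ x = D.germ x * E.germ x := rfl

instance : Nonempty (⊤ : X.Opens) := ⟨⟨genericPoint X, trivial⟩⟩

/-- The `Γ(X, 𝒪_X)`-module `H⁰(X, 𝒪_X(D))`: the rational functions `s` such that `s * g` is
regular at `x` for every point `x` and every local equation `g` of `D` at `x`. -/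
def globalSections (D : CartierDivisor X) : Submodule Γ(X, ⊤) X.functionField where
  carrier := {s | ∀ (x : X) (g : (X.functionField)ˣ), D.germ x = QuotientGroup.mk g →
    s * (g : X.functionField) ∈ (algebraMap (X.presheaf.stalk x) X.functionField).range}
  zero_mem' x g _ := by rw [zero_mul]; exact zero_mem _
  add_mem' {s t} hs ht x g hg := by
    rw [add_mul]; exact add_mem (hs x g hg) (ht x g hg)
  smul_mem' a s hs x g hg := by
    rw [Algebra.smul_def, mul_assoc]
    refine mul_mem ⟨X.presheaf.germ ⊤ x trivial a, ?_⟩ (hs x g hg)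
    exact Scheme.algebraMap_germ_eq_germToFunctionField (X := X) (U := ⊤) trivial a

lemma mul_mem_range_of_mem_stalkUnits {x : X} {s : X.functionField} {g h : (X.functionField)ˣ}
    (hgh : (QuotientGroup.mk g : (X.functionField)ˣ ⧸ stalkUnits X x) = QuotientGroup.mk h)
    (hs : s * (g : X.functionField) ∈ (algebraMap (X.presheaf.stalk x) X.functionField).range) :
    s * (h : X.functionField) ∈ (algebraMap (X.presheaf.stalk x) X.functionField).range := by
  obtain ⟨u, hu⟩ := QuotientGroup.eq.mp hgh
  have hh : (h : X.functionField) = g * algebraMap (X.presheaf.stalk x) X.functionField u := by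
    have h1 : h = g * (g⁻¹ * h) := by group
    rw [← hu] at h1
    exact congrArg Units.val h1
  rw [hh, ← mul_assoc]
  exact mul_mem hs ⟨_, rfl⟩

/-- `H⁰(X, 𝒪_X(iD)) · H⁰(X, 𝒪_X(jD)) ⊆ H⁰(X, 𝒪_X((i + j)D))` inside `K(X)`. -/
instance gradedMonoid_globalSections (D : CartierDivisor X) :
    SetLike.GradedMonoid (fun m : ℕ => globalSections (m • D)) where
  one_mem x g hg := by
    rw [zero_smul, CartierDivisor.germ_zero] at hg
    exact mul_mem_range_of_mem_stalkUnits hg (by simp)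
  mul_mem i j s t hs ht x g hg := by
    obtain ⟨a, ha⟩ := QuotientGroup.mk_surjective ((i • D).germ x)
    obtain ⟨b, hb⟩ := QuotientGroup.mk_surjective ((j • D).germ x)
    rw [add_smul, CartierDivisor.germ_add, ← ha, ← hb, ← QuotientGroup.mk_mul] at hg
    refine mul_mem_range_of_mem_stalkUnits hg ?_
    have h := mul_mem (hs x a ha.symm) (ht x b hb.symm)
    rwa [Units.val_mul, mul_mul_mul_comm]

/-- The section ring `R(X/Z, D) = ⨁_{m ≥ 0} H⁰(X, 𝒪_X(mD))` for `p : X ⟶ Z = Spec R`. The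
morphism `p` enters only through the `R`-algebra structure. -/
def SectionRing {R : Type u} [CommRing R] (_p : X ⟶ Spec (.of R)) (D : CartierDivisor X) :
    Type u :=
  ⨁ m : ℕ, globalSections (m • D)

section SectionRing

variable {R : Type u} [CommRing R] (p : X ⟶ Spec (.of R)) (D : CartierDivisor X)

instance : CommRing (SectionRing p D) :=
  inferInstanceAs (CommRing (⨁ m : ℕ, globalSections (m • D)))

instance : Algebra Γ(X, ⊤) (SectionRing p D) :=
  inferInstanceAs (Algebra Γ(X, ⊤) (⨁ m : ℕ, globalSections (m • D)))

/-- The `R`-algebra structure on `R(X/Z, D)`, through `R ≅ Γ(Z, 𝒪_Z) ⟶ Γ(X, 𝒪_X)`. -/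
instance : Algebra R (SectionRing p D) :=
  ((algebraMap Γ(X, ⊤) (SectionRing p D)).comp
    ((Scheme.ΓSpecIso (.of R)).inv ≫ p.appTop).hom).toAlgebra

end SectionRing

end Cartier

section Pullback

variable {X Y : Scheme.{u}} [IsIntegral X] [IsIntegral Y] (f : X ⟶ Y) [IsDominant f]

lemma map_genericPoint_specializes : f (genericPoint X) ⤳ genericPoint Y := by
  have h : IsGenericPoint (f (genericPoint X)) (closure (Set.range f)) := by
    have := (genericPoint_spec X).image f.continuous
    rwa [Set.image_univ] at this
  rw [f.denseRange.closure_range] at h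
  exact specializes_of_eq (h.eq (genericPoint_spec Y))

/-- The inclusion of function fields `K(Y) ⟶ K(X)` induced by a dominant morphism `X ⟶ Y`. -/
def functionFieldMap : Y.functionField ⟶ X.functionField :=
  Y.presheaf.stalkSpecializes (map_genericPoint_specializes f) ≫ f.stalkMap (genericPoint X)

lemma functionFieldMap_algebraMap (x : X) (a : Y.presheaf.stalk (f x)) :
    (functionFieldMap f).hom (algebraMap (Y.presheaf.stalk (f x)) Y.functionField a) =
      algebraMap (X.presheaf.stalk x) X.functionField ((f.stalkMap x).hom a) := by
  have h := f.stalkSpecializes_stalkMap_apply (genericPoint X) x (genericPoint_specializes x) a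
  refine Eq.trans (congrArg (f.stalkMap (genericPoint X)).hom ?_) h
  exact congrArg (fun φ => φ.hom a)
    (Y.presheaf.stalkSpecializes_comp (map_genericPoint_specializes f)
      (genericPoint_specializes (f x)))

/-- Pullback of germs `K(Y)ˣ / 𝒪_{Y,f(x)}ˣ → K(X)ˣ / 𝒪_{X,x}ˣ`. -/
def pullbackGerm (x : X) :
    (Y.functionField)ˣ ⧸ stalkUnits Y (f x) →* (X.functionField)ˣ ⧸ stalkUnits X x :=
  QuotientGroup.map _ _ (Units.map (functionFieldMap f).hom.toMonoidHom) (by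
    rintro _ ⟨u, rfl⟩
    refine ⟨Units.map (f.stalkMap x).hom.toMonoidHom u, Units.ext ?_⟩
    exact (functionFieldMap_algebraMap f x u).symm)

/-- The pullback `f^*D` of a Cartier divisor along a dominant morphism of integral schemes:
the local equations are pulled back along `K(Y) ⟶ K(X)`. -/
def CartierDivisor.pullback (D : CartierDivisor Y) : CartierDivisor X :=
  Additive.ofMul (⟨fun x => pullbackGerm f x (D.germ (f x)), fun x => by
    obtain ⟨U, g, hxU, hg⟩ := (Additive.toMul D : cartierSubgroup Y).2 (f x)
    refine ⟨f ⁻¹ᵁ U, Units.map (functionFieldMap f).hom.toMonoidHom g, hxU, fun y hy => ?_⟩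
    change pullbackGerm f y ((Additive.toMul D : cartierSubgroup Y).1 (f y)) = _
    rw [hg (f y) hy]
    rfl⟩ : cartierSubgroup X)

end Pullback

end SectionRings

end

/-! Pullback of sections embeds A = R(Y/Z, L) in B = R(X/Z, f^*L), and B is integral over A. Indeed,
let s be a section of f^*(mL), with minimal polynomial P of degree d over K(Y), and let g be a local
equation of mL at y. Since f is proper, sg is integral over the local ring of Y at y. That ring is
integrally closed, so it contains the coefficients of the minimal polynomial of sg. Hence the
coefficient of P of index d - i is a section of imL (`coeff_minpoly_mem_globalSections`), and P
becomes a homogeneous monic equation for s over A (`pullback_isIntegral`). If B is of finite type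
over R, it is then finite over A, and the Artin–Tate lemma over the noetherian ring R gives the
claim. -/

noncomputable section

namespace SectionRings

universe u

/-! ### Projective morphisms are proper. -/

section Projective

attribute [local instance] MvPolynomial.gradedAlgebra

lemma algebraMap_homogeneousSubmodule_zero_surjective (σ R : Type*) [CommRing R] :
    Function.Surjective (algebraMap R (MvPolynomial.homogeneousSubmodule σ R 0)) := by
  rintro ⟨a, ha⟩
  rw [MvPolynomial.homogeneousSubmodule_zero, Submodule.mem_one] at ha
  obtain ⟨r, rfl⟩ := ha
  exact ⟨r, Subtype.ext rfl⟩

instance isProper_projectiveSpace_toBase (n : ℕ) (R : Type u) [CommRing R] :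
    IsProper (ProjectiveSpace.toBase n R) := by
  have : IsScalarTower R (MvPolynomial.homogeneousSubmodule (Fin (n + 1)) R 0)
      (MvPolynomial (Fin (n + 1)) R) := ⟨fun r a b => smul_mul_assoc r a.1 b⟩
  have : Algebra.FiniteType (MvPolynomial.homogeneousSubmodule (Fin (n + 1)) R 0)
      (MvPolynomial (Fin (n + 1)) R) :=
    Algebra.FiniteType.of_restrictScalars_finiteType R _ _
  have : IsClosedImmersion (Spec.map (CommRingCat.ofHom
      (algebraMap R (MvPolynomial.homogeneousSubmodule (Fin (n + 1)) R 0)))) :=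
    IsClosedImmersion.spec_of_surjective _
      (algebraMap_homogeneousSubmodule_zero_surjective _ _)
  have h1 : IsProper (Proj.toSpecZero (MvPolynomial.homogeneousSubmodule (Fin (n + 1)) R)) :=
    inferInstance
  have h2 : IsProper (Spec.map (CommRingCat.ofHom
      (algebraMap R (MvPolynomial.homogeneousSubmodule (Fin (n + 1)) R 0)))) := inferInstance
  exact MorphismProperty.comp_mem @IsProper _ _ h1 h2

lemma IsProjectiveMorphism.isProper {X : Scheme.{u}} {R : Type u} [CommRing R]
    {p : X ⟶ Spec (.of R)} (hp : IsProjectiveMorphism p) : IsProper p := by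
  obtain ⟨n, i, hi, rfl⟩ := hp
  infer_instance

end Projective

/-! ### Integrality over affine opens, and rational functions as sections. -/

section Sections

variable {X Y : Scheme.{u}}

lemma isIntegral_app_of_universallyClosed (f : X ⟶ Y) [UniversallyClosed f] {U : Y.Opens}
    (hU : IsAffineOpen U) : (f.app U).hom.IsIntegral := by
  have : IsAffine U := hU
  have : UniversallyClosed (f ∣_ U) := MorphismProperty.of_isPullback
    (P := @UniversallyClosed) (isPullback_morphismRestrict f U).flip ‹_›
  have h := isIntegral_appTop_of_universallyClosed (f ∣_ U)
  rw [morphismRestrict_appTop] at h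
  have e : U.ι ''ᵁ ⊤ = U := by simp
  -- On global sections `f ∣_ U` is `f.app` followed by an isomorphism; as that isomorphism is
  -- injective, a monic equation for the image of `x` already holds for `x`.
  have h' : (f.app (U.ι ''ᵁ ⊤)).hom.IsIntegral := by
    intro x
    obtain ⟨P, hP, hPx⟩ := h ((X.presheaf.map
      (eqToHom (image_morphismRestrict_preimage f U ⊤)).op).hom x)
    refine ⟨P, hP, ?_⟩
    replace hPx := (Polynomial.hom_eval₂ P (f.app (U.ι ''ᵁ ⊤)).hom (X.presheaf.map
      (eqToHom (image_morphismRestrict_preimage f U ⊤)).op).hom x).trans hPx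
    apply ((ConcreteCategory.isIso_iff_bijective (X.presheaf.map
      (eqToHom (image_morphismRestrict_preimage f U ⊤)).op)).mp inferInstance).1
    rw [map_zero]
    exact hPx
  rwa [e] at h'

/-- Local representatives of `s` glue: on an integral scheme the germ at the generic point is
injective, so they agree on overlaps. -/
lemma exists_germToFunctionField_eq [IsIntegral X] (U : X.Opens) [Nonempty U]
    (s : X.functionField)
    (hs : ∀ x ∈ U, s ∈ (algebraMap (X.presheaf.stalk x) X.functionField).range) :
    ∃ σ : Γ(X, U), X.germToFunctionField U σ = s := by
  have key : ∀ x : U, ∃ (V : X.Opens) (_ : Nonempty V) (_ : x.1 ∈ V) (_ : V ≤ U) (σ : Γ(X, V)),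
      X.germToFunctionField V σ = s := by
    intro x
    obtain ⟨a, rfl⟩ := hs x.1 x.2
    obtain ⟨V, hxV, σ, rfl⟩ := X.presheaf.exists_germ_eq a
    have : Nonempty (V ⊓ U : X.Opens) := ⟨⟨x.1, hxV, x.2⟩⟩
    refine ⟨V ⊓ U, this, ⟨hxV, x.2⟩, inf_le_right,
      X.presheaf.map (homOfLE inf_le_left).op σ, ?_⟩
    rw [← Scheme.algebraMap_germ_eq_germToFunctionField _ (x := x.1)
      (show x.1 ∈ V ⊓ U from ⟨hxV, x.2⟩)]
    congr 1
    exact X.presheaf.germ_res_apply (homOfLE inf_le_left) x.1 ⟨hxV, x.2⟩ σ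
  choose V hne hxV hVU σ hσ using key
  have hgen : ∀ (W : X.Opens) [Nonempty W], genericPoint X ∈ W := fun W hW =>
    ((genericPoint_spec X).mem_open_set_iff W.isOpen).mpr (by simpa using hW)
  obtain ⟨τ, hτ, -⟩ := X.sheaf.existsUnique_gluing' V U (fun i => homOfLE (hVU i))
    (fun x hx => TopologicalSpace.Opens.mem_iSup.mpr ⟨⟨x, hx⟩, hxV ⟨x, hx⟩⟩) σ (by
      intro i j
      have hmem : genericPoint X ∈ V i ⊓ V j :=
        ⟨@hgen _ (hne i), @hgen _ (hne j)⟩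
      apply germ_injective_of_isIntegral (X := X) (genericPoint X) hmem
      refine (X.presheaf.germ_res_apply _ (genericPoint X) hmem (σ i)).trans ?_
      refine Eq.trans ?_ (X.presheaf.germ_res_apply _ (genericPoint X) hmem (σ j)).symm
      exact (hσ i).trans (hσ j).symm)
  refine ⟨τ, ?_⟩
  obtain ⟨x⟩ := ‹Nonempty U›
  rw [← hσ x, ← hτ x]
  exact (X.presheaf.germ_res_apply (homOfLE (hVU x)) (genericPoint X) (@hgen _ (hne x)) τ).symm

variable [IsIntegral X] [IsIntegral Y] (f : X ⟶ Y) [IsDominant f]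

lemma functionFieldMap_germToFunctionField (U : Y.Opens) [Nonempty U]
    [Nonempty (f ⁻¹ᵁ U : X.Opens)] (a : Γ(Y, U)) :
    (functionFieldMap f).hom (Y.germToFunctionField U a) =
      X.germToFunctionField (f ⁻¹ᵁ U) (f.app U a) := by
  obtain ⟨x, hx⟩ := ‹Nonempty (f ⁻¹ᵁ U : X.Opens)›
  rw [← Scheme.algebraMap_germ_eq_germToFunctionField _ (x := f x) hx a,
    functionFieldMap_algebraMap,
    ← Scheme.algebraMap_germ_eq_germToFunctionField _ (x := x) hx]
  congr 1
  exact Scheme.Hom.germ_stalkMap_apply f U x hx a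

end Sections

/-! ### Minimal polynomials over an integrally closed domain. -/

section Algebra

open Polynomial

/-- Scaling the roots of the minimal polynomial of `s` by `g` gives that of `g • s`, which has
coefficients in `A` because `g • s` is integral over `A`. The scaling multiplies the coefficient of
index `d - i` by `g ^ i`, where `d` is the degree. -/
lemma coeff_minpoly_mul_pow_mem_range {A K F : Type*} [CommRing A] [IsDomain A]
    [IsIntegrallyClosed A] [Field K] [Algebra A K] [IsFractionRing A K] [Field F] [Algebra K F]
    {s : F} {g : K} (hg : g ≠ 0)
    (h : ((algebraMap K F).comp (algebraMap A K)).IsIntegralElem (s * algebraMap K F g))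
    {i : ℕ} (hi : i ≤ (minpoly K s).natDegree) :
    (minpoly K s).coeff ((minpoly K s).natDegree - i) * g ^ i ∈ (algebraMap A K).range := by
  let : Algebra A F := ((algebraMap K F).comp (algebraMap A K)).toAlgebra
  have : IsScalarTower A K F := .of_algebraMap_eq' rfl
  have h1 : IsIntegral A (g • s) := by
    rw [Algebra.smul_def, mul_comm]; exact h
  have h2 : IsIntegral K s := by
    have := (h1.tower_top (A := K)).smul g⁻¹
    rwa [smul_smul, inv_mul_cancel₀ hg, one_smul] at this
  have h3 : (minpoly K s).scaleRoots g = (minpoly A (g • s)).map (algebraMap A K) := by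
    rw [← IsIntegrallyClosed.minpoly_smul hg h2,
      minpoly.isIntegrallyClosed_eq_field_fractions' K h1]
  refine ⟨(minpoly A (g • s)).coeff ((minpoly K s).natDegree - i), ?_⟩
  rw [← coeff_map, ← h3, coeff_scaleRoots, Nat.sub_sub_self hi]

end Algebra

/-! ### Sections of a pulled-back divisor are integral. -/

section Integrality

variable {X Y : Scheme.{u}} [IsIntegral X] [IsIntegral Y]

lemma CartierDivisor.germ_nsmul (D : CartierDivisor X) (n : ℕ) (x : X) :
    (n • D).germ x = D.germ x ^ n := by
  induction n with
  | zero => rw [zero_smul, pow_zero, germ_zero, QuotientGroup.mk_one]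
  | succ n ih => rw [succ_nsmul, germ_add, ih, pow_succ]

@[ext]
lemma CartierDivisor.ext {D E : CartierDivisor X} (h : ∀ x, D.germ x = E.germ x) : D = E :=
  congrArg Additive.ofMul (Subtype.ext (funext h) : Additive.toMul D = Additive.toMul E)

variable (f : X ⟶ Y) [IsDominant f]

lemma CartierDivisor.germ_pullback (D : CartierDivisor Y) (x : X) :
    (D.pullback f).germ x = pullbackGerm f x (D.germ (f x)) := rfl

lemma CartierDivisor.pullback_nsmul (n : ℕ) (D : CartierDivisor Y) :
    (n • D).pullback f = n • D.pullback f := by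
  ext x
  rw [germ_pullback, germ_nsmul, germ_nsmul, germ_pullback, map_pow]

lemma functionFieldMap_mem_globalSections {D : CartierDivisor Y} {s : Y.functionField}
    (hs : s ∈ globalSections D) :
    (functionFieldMap f).hom s ∈ globalSections (D.pullback f) := by
  intro x g hg
  obtain ⟨h, hh⟩ := QuotientGroup.mk_surjective (D.germ (f x))
  obtain ⟨a, ha⟩ := hs (f x) h hh.symm
  rw [CartierDivisor.germ_pullback, ← hh] at hg
  refine mul_mem_range_of_mem_stalkUnits
    (g := Units.map (functionFieldMap f).hom.toMonoidHom h) hg ?_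
  refine ⟨(f.stalkMap x).hom a, ?_⟩
  rw [← functionFieldMap_algebraMap, ha, map_mul]
  rfl

/-- If `g` is a local equation of `D` at `y`, then `s * g` is integral over `𝒪_{Y,y}` for every
section `s` of `f^*D`. -/
lemma isIntegralElem_mul_of_mem_globalSections_pullback [Surjective f] [UniversallyClosed f]
    {D : CartierDivisor Y} {s : X.functionField} (hs : s ∈ globalSections (D.pullback f)) (y : Y) :
    ∃ g : (Y.functionField)ˣ, D.germ y = QuotientGroup.mk g ∧
      ((functionFieldMap f).hom.comp
        (algebraMap (Y.presheaf.stalk y) Y.functionField)).IsIntegralElem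
          (s * (functionFieldMap f).hom g) := by
  obtain ⟨U, g, hyU, hg⟩ := (Additive.toMul D : cartierSubgroup Y).2 y
  obtain ⟨_, ⟨V, hV, rfl⟩, hyV, hVU⟩ :=
    Y.isBasis_affineOpens.exists_subset_of_mem_open hyU U.isOpen
  refine ⟨g, hg y hyU, ?_⟩
  obtain ⟨x, rfl⟩ := f.surjective y
  have : Nonempty V := ⟨⟨_, hyV⟩⟩
  have : Nonempty (f ⁻¹ᵁ V : X.Opens) := ⟨⟨x, hyV⟩⟩
  -- The single `g` is a local equation on all of `V`, so `s * g` is a section over the preimage of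
  -- the affine open `V`; its monic equation over `Γ(Y, V)` is then mapped to the stalk.
  obtain ⟨σ, hσ⟩ := exists_germToFunctionField_eq (f ⁻¹ᵁ V) (s * (functionFieldMap f).hom g)
    fun z hz => hs z (Units.map (functionFieldMap f).hom.toMonoidHom g) (by
      rw [CartierDivisor.germ_pullback, show D.germ (f z) = _ from hg (f z) (hVU hz)]
      rfl)
  obtain ⟨P, hP, hPσ⟩ := isIntegral_app_of_universallyClosed f hV σ
  refine ⟨P.map (Y.presheaf.germ V (f x) hyV).hom, hP.map _, ?_⟩
  have hcomp : ((functionFieldMap f).hom.comp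
      (algebraMap (Y.presheaf.stalk (f x)) Y.functionField)).comp
        (Y.presheaf.germ V (f x) hyV).hom =
      (X.germToFunctionField (f ⁻¹ᵁ V)).hom.comp (f.app V).hom := by
    ext a
    simp only [RingHom.comp_apply]
    rw [← functionFieldMap_germToFunctionField]
    congr 1
    exact Scheme.algebraMap_germ_eq_germToFunctionField _ hyV a
  rw [Polynomial.eval₂_map, hcomp, ← hσ, ← Polynomial.hom_eval₂, hPσ, map_zero]

lemma isIntegral_of_mem_globalSections_pullback [Surjective f] [UniversallyClosed f]
    [Algebra Y.functionField X.functionField]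
    (halg : algebraMap Y.functionField X.functionField = (functionFieldMap f).hom)
    {D : CartierDivisor Y} {s : X.functionField} (hs : s ∈ globalSections (D.pullback f)) :
    _root_.IsIntegral Y.functionField s := by
  obtain ⟨g, -, hg⟩ :=
    isIntegralElem_mul_of_mem_globalSections_pullback f hs (genericPoint Y)
  rw [← halg] at hg
  have h1 : _root_.IsIntegral Y.functionField (g.1 • s) := by
    rw [Algebra.smul_def, mul_comm]
    exact RingHom.IsIntegralElem.of_comp hg
  have h2 := h1.smul (g⁻¹).1
  rwa [smul_smul, g.inv_mul, one_smul] at h2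

/-- The coefficients of the minimal polynomial over `K(Y)` of a section of `f^*D` are sections of
multiples of `D`. -/
lemma coeff_minpoly_mem_globalSections (hY : IsNormalScheme Y) [Surjective f]
    [UniversallyClosed f] [Algebra Y.functionField X.functionField]
    (halg : algebraMap Y.functionField X.functionField = (functionFieldMap f).hom)
    {D : CartierDivisor Y} {s : X.functionField} (hs : s ∈ globalSections (D.pullback f)) {i : ℕ}
    (hi : i ≤ (minpoly Y.functionField s).natDegree) :
    (minpoly Y.functionField s).coeff ((minpoly Y.functionField s).natDegree - i) ∈
      globalSections (i • D) := by
  intro y g' hg'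
  obtain ⟨g, hg, hint⟩ := isIntegralElem_mul_of_mem_globalSections_pullback f hs y
  rw [CartierDivisor.germ_nsmul, hg, ← QuotientGroup.mk_pow] at hg'
  refine mul_mem_range_of_mem_stalkUnits hg' ?_
  have := (hY y).2
  rw [← halg] at hint
  rw [Units.val_pow_eq_pow_val]
  exact coeff_minpoly_mul_pow_mem_range g.ne_zero hint hi

end Integrality

open Polynomial

/-! ### The section ring inside K(X)[T]. -/

section SectionRing

variable {X : Scheme.{u}} [IsIntegral X] {R : Type u} [CommRing R] (p : X ⟶ Spec (.of R))
  (D : CartierDivisor X)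

namespace SectionRing

/-- The homogeneous element of degree `m` of the section ring given by `s ∈ H⁰(X, 𝒪_X(mD))`. -/
def of (m : ℕ) (s : globalSections (m • D)) : SectionRing p D :=
  DirectSum.of (fun m : ℕ => globalSections (m • D)) m s

/-- The embedding of the section ring into `K(X)[T]`, sending `s` of degree `m` to `s * T ^ m`. -/
def toPolynomial : SectionRing p D →+* X.functionField[X] :=
  DirectSum.toSemiring
    (fun m => (monomial m).toAddMonoidHom.comp (globalSections (m • D)).subtype.toAddMonoidHom)
    monomial_zero_one (fun _ _ => (monomial_mul_monomial _ _ _ _).symm)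

@[simp]
lemma toPolynomial_of (m : ℕ) (s : globalSections (m • D)) :
    toPolynomial p D (of p D m s) = monomial m s.1 :=
  DirectSum.toSemiring_of _ _ _ _ _

variable {p D} in
@[elab_as_elim]
lemma induction_on {motive : SectionRing p D → Prop} (a : SectionRing p D)
    (zero : motive 0) (of : ∀ m s, motive (of p D m s))
    (add : ∀ a b, motive a → motive b → motive (a + b)) : motive a :=
  DirectSum.induction_on a zero of add

/-- This yields injectivity of `toPolynomial`, so that identities in the section ring can be checked
in K(X)[T]. -/
lemma coeff_toPolynomial (a : SectionRing p D) (m : ℕ) :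
    (toPolynomial p D a).coeff m =
      (DirectSum.component Γ(X, ⊤) ℕ (fun m => globalSections (m • D)) m a).1 := by
  induction a using induction_on with
  | zero =>
    rw [map_zero, coeff_zero]
    exact congrArg Subtype.val 
      (map_zero (DirectSum.component Γ(X, ⊤) ℕ (fun m => globalSections (m • D)) m)).symm
  | of k s =>
    rw [toPolynomial_of, coeff_monomial]
    split_ifs with h
    · subst h
      exact congrArg Subtype.val
        (DirectSum.of_eq_same (β := fun m : ℕ => globalSections (m • D)) k s).symm
    · exact congrArg Subtype.val
        (DirectSum.of_eq_of_ne (β := fun m : ℕ => globalSections (m • D)) k m s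
          (Ne.symm h)).symm
  | add a b ha hb =>
    rw [map_add, coeff_add, ha, hb]
    exact congrArg Subtype.val
      (map_add (DirectSum.component Γ(X, ⊤) ℕ (fun m => globalSections (m • D)) m) a b).symm

lemma toPolynomial_injective : Function.Injective (toPolynomial p D) := by
  intro a b hab
  refine DFinsupp.ext fun m => Subtype.ext ?_
  exact (coeff_toPolynomial p D a m).symm.trans (hab ▸ coeff_toPolynomial p D b m)

lemma toPolynomial_algebraMap (r : R) :
    toPolynomial p D (algebraMap R (SectionRing p D) r) =
      C (X.germToFunctionField ⊤ (p.appTop ((Scheme.ΓSpecIso (.of R)).inv r))) :=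
  DirectSum.toSemiring_of _ _ _ _ _

end SectionRing

end SectionRing

/-! ### Pullback of section rings, and descent of finite generation. -/

section Pullback

variable {X Y : Scheme.{u}} [IsIntegral X] [IsIntegral Y] {R : Type u} [CommRing R]
  (p : X ⟶ Spec (.of R)) (q : Y ⟶ Spec (.of R)) (f : X ⟶ Y) [IsDominant f]
  (D : CartierDivisor Y)

namespace SectionRing

lemma functionFieldMap_mem_globalSections_nsmul (m : ℕ) (s : globalSections (m • D)) :
    (functionFieldMap f).hom s.1 ∈ globalSections (m • D.pullback f) :=
  CartierDivisor.pullback_nsmul f m D ▸ functionFieldMap_mem_globalSections f s.2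

/-- Pullback of sections as a ring homomorphism `R(Y/Z, D) → R(X/Z, f^*D)`. -/
def pullback : SectionRing q D →+* SectionRing p (D.pullback f) :=
  DirectSum.toSemiring
    (fun m => (DirectSum.of (fun m : ℕ => globalSections (m • D.pullback f)) m).comp
      { toFun s := ⟨_, functionFieldMap_mem_globalSections_nsmul f D m s⟩
        map_zero' := Subtype.ext (map_zero (functionFieldMap f).hom)
        map_add' s t := Subtype.ext (map_add (functionFieldMap f).hom s.1 t.1) })
    (congrArg (DirectSum.of (fun m : ℕ => globalSections (m • D.pullback f)) 0)
      (Subtype.ext (map_one (functionFieldMap f).hom)))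
    (fun {i j} s t => by
      refine Eq.trans ?_ (DirectSum.of_mul_of _ _).symm
      exact congrArg (DirectSum.of (fun m : ℕ => globalSections (m • D.pullback f)) (i + j))
        (Subtype.ext (map_mul (functionFieldMap f).hom s.1 t.1)))

lemma toPolynomial_pullback (a : SectionRing q D) :
    toPolynomial p (D.pullback f) (pullback p q f D a) =
      (toPolynomial q D a).map (functionFieldMap f).hom := by
  induction a using induction_on with
  | zero => simp
  | of m s =>
    rw [toPolynomial_of, map_monomial, ← toPolynomial_of p (D.pullback f) m
      ⟨_, functionFieldMap_mem_globalSections_nsmul f D m s⟩]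
    congr 1
    exact DirectSum.toSemiring_of _ _ _ _ _
  | add a b ha hb => rw [map_add, map_add, ha, hb, map_add, Polynomial.map_add]

lemma pullback_injective : Function.Injective (pullback p q f D) := by
  have h : Function.Injective (toPolynomial p (D.pullback f) ∘ pullback p q f D) := by
    intro a b hab
    simp only [Function.comp_apply, toPolynomial_pullback] at hab
    exact toPolynomial_injective q D (map_injective _ (functionFieldMap f).hom.injective hab)
  exact h.of_comp

lemma pullback_algebraMap (hf : f ≫ q = p) (r : R) :
    pullback p q f D (algebraMap R _ r) = algebraMap R _ r := by
  apply toPolynomial_injective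
  rw [toPolynomial_pullback, toPolynomial_algebraMap, toPolynomial_algebraMap, map_C, ← hf]
  congr 1
  have : Nonempty (f ⁻¹ᵁ ⊤ : X.Opens) := inferInstanceAs (Nonempty (⊤ : X.Opens))
  exact functionFieldMap_germToFunctionField f ⊤ _

/-- Integral elements are closed under addition, so homogeneous ones suffice; for these the minimal
polynomial over K(Y) is homogenized. -/
lemma pullback_isIntegral (hY : IsNormalScheme Y) [Surjective f] [UniversallyClosed f] :
    (pullback p q f D).IsIntegral := by
  let : Algebra Y.functionField X.functionField := (functionFieldMap f).hom.toAlgebra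
  intro a
  induction a using induction_on with
  | zero => exact (pullback p q f D).isIntegralElem_zero
  | add a b ha hb => exact ha.add _ hb
  | of m s =>
    have hs : s.1 ∈ globalSections ((m • D).pullback f) :=
      (CartierDivisor.pullback_nsmul f m D).symm ▸ s.2
    have hint := isIntegral_of_mem_globalSections_pullback f rfl hs
    set P := minpoly Y.functionField s.1
    -- The coefficient of index `i` is placed in degree `(d - i) * m`, with `d = P.natDegree`, so
    -- that every term of the equation has degree `m * d`.
    have hc : ∀ i : Fin P.natDegree, P.coeff i ∈ 
        globalSections (((P.natDegree - i : ℕ) * m) • D) := by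
      intro i
      have := coeff_minpoly_mem_globalSections f hY rfl hs (i := P.natDegree - i) (Nat.sub_le _ _)
      rwa [Nat.sub_sub_self i.2.le, smul_smul] at this
    refine ⟨Polynomial.X ^ P.natDegree + ∑ i : Fin P.natDegree, C (of q D _ ⟨_, hc i⟩) *
      Polynomial.X ^ (i : ℕ),
      monic_X_pow_add (degree_sum_fin_lt _), ?_⟩
    apply toPolynomial_injective
    have key : ∑ i : Fin P.natDegree, (functionFieldMap f).hom (P.coeff i) * s.1 ^ (i : ℕ) +
        s.1 ^ P.natDegree = 0 := by
      have h := minpoly.aeval Y.functionField s.1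
      rw [aeval_eq_sum_range, Finset.sum_range_succ, (minpoly.monic hint).coeff_natDegree,
        one_smul, Finset.sum_range] at h
      simp only [Algebra.smul_def] at h
      exact h
    simp only [eval₂_add, eval₂_X_pow, eval₂_finsetSum, eval₂_mul, eval₂_C, map_add, map_pow,
      map_sum, map_mul, map_zero, toPolynomial_pullback, toPolynomial_of, map_monomial,
      monomial_pow, monomial_mul_monomial]
    have hdeg : ∀ i : Fin P.natDegree, (P.natDegree - i) * m + m * i = m * P.natDegree := by
      intro i
      rw [mul_comm, ← mul_add, Nat.sub_add_cancel i.2.le]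
    simp only [hdeg, ← map_sum, ← map_add]
    rw [add_comm, key, map_zero]

end SectionRing

lemma finiteType_sectionRing_of_pullback [IsNoetherianRing R] (hY : IsNormalScheme Y)
    [Surjective f] [UniversallyClosed f] (hf : f ≫ q = p)
    (hfg : Algebra.FiniteType R (SectionRing p (D.pullback f))) :
    Algebra.FiniteType R (SectionRing q D) := by
  let φ := SectionRing.pullback p q f D
  let : Algebra (SectionRing q D) (SectionRing p (D.pullback f)) := φ.toAlgebra
  have : IsScalarTower R (SectionRing q D) (SectionRing p (D.pullback f)) :=
    .of_algebraMap_eq fun r => (SectionRing.pullback_algebraMap p q f D hf r).symm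
  have : Algebra.IsIntegral (SectionRing q D) (SectionRing p (D.pullback f)) :=
    ⟨SectionRing.pullback_isIntegral p q f D hY⟩
  have : Algebra.FiniteType (SectionRing q D) (SectionRing p (D.pullback f)) :=
    .of_restrictScalars_finiteType R _ _
  have : Module.Finite (SectionRing q D) (SectionRing p (D.pullback f)) :=
    Algebra.IsIntegral.finite
  -- The Artin–Tate lemma for R → A → B with A → B injective and finite.
  exact ⟨fg_of_fg_of_fg _ _ _ hfg.out this.fg_top (SectionRing.pullback_injective p q f D)⟩

end Pullback

end SectionRings

end

theorem theorem5p9 {R : Type} [CommRing R] [IsDomain R] [Algebra ℂ R] [Algebra.FiniteType ℂ R]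
    {X Y : AlgebraicGeometry.Scheme.{0}} [AlgebraicGeometry.IsIntegral X]
    [AlgebraicGeometry.IsIntegral Y]
    (hX : SectionRings.IsNormalScheme X) (hY : SectionRings.IsNormalScheme Y)
    (p : X ⟶ Spec (.of R)) (q : Y ⟶ Spec (.of R))
    (hp : SectionRings.IsProjectiveMorphism p) (hq : SectionRings.IsProjectiveMorphism q)
    (f : X ⟶ Y) [AlgebraicGeometry.Surjective f] (hf : f ≫ q = p)
    (L : SectionRings.CartierDivisor Y)
    (hfg : Algebra.FiniteType R (SectionRings.SectionRing p (L.pullback f))) :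
    Algebra.FiniteType R (SectionRings.SectionRing q L) := by
  have := Algebra.FiniteType.isNoetherianRing ℂ R
  have := hq.isProper
  have : IsProper (f ≫ q) := hf ▸ hp.isProper
  -- Properness cancels on the left because `q` is separated.
  have : IsProper f := .of_comp f q
  exact SectionRings.finiteType_sectionRing_of_pullback p q f L hY hf hfg
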